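/- Let $n\ge 1$ and $k>n$ be integers. Let $\mathbb H^n=\mathbb R^{2n+1}$ be the Heisenberg group, with coordinates $(x_1,y_1,\dots,x_n,y_n,t)$, left-invariant horizontal vector fields $$X_j=\frac{\partial}{\partial x_j}+2y_j\frac{\partial}{\partial t},\qquad Y_j=\frac{\partial}{\partial y_j}-2x_j\frac{\partial}{\partial t}\qquad(j=1,\dots,n),$$ and the Carnot–Carathéodory distance $d_{cc}$: $d_{cc}(p,q)$ is the infimum of the lengths of horizontal curves from $p$ to $q$. A curve is horizontal if it is absolutely continuous and its velocity lies almost everywhere in the span of the $X_j,Y_j$; lengths are computed with respect to the inner product for which the $X_j,Y_j$ are orthonormal. Let $\pi:\mathbb R^{2n+1}\to\mathbb R^{2n}$, $\pi(x_1,y_1,\dots,x_n,y_n,t)=(x_1,y_1,\dots,x_n,y_n)$. A linear subspace $V\subset\mathbb R^{2n}$ is isotropic if $\omega(v,w)=\sum_{j=1}^n\left(v^{x_j}w^{y_j}-v^{y_j}w^{x_j}\right)=0$ for all $v,w\in V$. For a map $h:E\to\mathbb R^m$, $E\subset\mathbb R^k$, and $x\in E$, a linear map $A:\mathbb R^k\to\mathbb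 R^m$ is the approximate derivative $\operatorname{ap} dh_x$ of $h$ at $x$ if for every $\varepsilon>0$ the complement of the set $\{y\in E:\ |h(y)-h(x)-A(y-x)|\le\varepsilon|y-x|\}$ has Lebesgue density zero at $x$. Let $E\subset\mathbb R^k$ be Lebesgue measurable and let $f:E\to(\mathbb H^n,d_{cc})$ be locally Lipschitz, i.e. every point of $E$ has a neighbourhood in $E$ on which $f$ is Lipschitz with respect to the Euclidean distance on $E$ and $d_{cc}$. Then, at almost every point $x\in E$ (with respect to Lebesgue measure, equivalently $\mathcal H^k$), the maps $f:E\to\mathbb R^{2n+1}$ and $\pi\circ f:E\to\mathbb R^{2n}$ have approximate derivatives, and $$\operatorname{rank}\,\operatorname{ap} df_x\le n .$$ Moreover, at almost every $x\in E$ the image of $\operatorname{ap} d(\pi\circ f)_x$ is an isotropic subspace of $\mathbb R^{2n}$. -/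

import Mathlib

open MeasureTheory Set Filter Topology

noncomputable section

namespace HeisenbergRank

/-- The space `ℝ^{2n}` with coordinates `(x, y)`:
`v (Sum.inl j)` is `x_j` and `v (Sum.inr j)` is `y_j`. -/
abbrev Plane (n : ℕ) : Type := EuclideanSpace ℝ (Fin n ⊕ Fin n)

/-- The underlying space `ℝ^{2n+1}` of the Heisenberg group `ℍ^n`, with coordinates `(x, y, t)`:
`p (Sum.inl (Sum.inl j))` is `x_j`, `p (Sum.inl (Sum.inr j))` is `y_j` and `p (Sum.inr ())` is
`t`. Its norm is the Euclidean one; the Carnot–Carathéodory distance is `ccEDist` below. -/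
abbrev Space (n : ℕ) : Type := EuclideanSpace ℝ ((Fin n ⊕ Fin n) ⊕ Unit)

variable {n : ℕ}

/-- The coordinate `x_j`. -/
def xc (p : Space n) (j : Fin n) : ℝ := p (Sum.inl (Sum.inl j))

/-- The coordinate `y_j`. -/
def yc (p : Space n) (j : Fin n) : ℝ := p (Sum.inl (Sum.inr j))

/-- The coordinate vector `∂/∂x_j`. -/
def dx (j : Fin n) : Space n := EuclideanSpace.single (Sum.inl (Sum.inl j)) 1

/-- The coordinate vector `∂/∂y_j`. -/
def dy (j : Fin n) : Space n := EuclideanSpace.single (Sum.inl (Sum.inr j)) 1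

/-- The coordinate vector `∂/∂t`. -/
def dt (n : ℕ) : Space n := EuclideanSpace.single (Sum.inr ()) 1

/-- The left-invariant vector field `X_j = ∂/∂x_j + 2 y_j ∂/∂t`. -/
def fieldX (j : Fin n) (p : Space n) : Space n := dx j + (2 * yc p j) • dt n

/-- The left-invariant vector field `Y_j = ∂/∂y_j - 2 x_j ∂/∂t`. -/
def fieldY (j : Fin n) (p : Space n) : Space n := dy j - (2 * xc p j) • dt n

/-- The horizontal space `H_p ℍ^n`, spanned by the `X_j(p)` and the `Y_j(p)`. -/
def horizontalSpace (p : Space n) : Submodule ℝ (Space n) :=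
  Submodule.span ℝ (range (fun j => fieldX j p) ∪ range (fun j => fieldY j p))

/-- The sub-Riemannian norm of a horizontal vector, for which the `X_j(p)` and the `Y_j(p)` are
orthonormal; see `horizontalNorm_frame`. -/
def horizontalNorm (v : Space n) : ℝ := √(∑ j, (xc v j ^ 2 + yc v j ^ 2))

theorem horizontalNorm_frame (p : Space n) (a b : Fin n → ℝ) :
    horizontalNorm (∑ j, (a j • fieldX j p + b j • fieldY j p))
      = √(∑ j, (a j ^ 2 + b j ^ 2)) := by
  unfold horizontalNorm
  congr 1
  refine Finset.sum_congr rfl fun i _ => ?_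
  simp [xc, yc, fieldX, fieldY, dx, dy, dt, Pi.single_apply, Finset.sum_apply]

/-- A horizontal curve `γ : [a, b] → ℝ^{2n+1}`: it is absolutely continuous, and for almost every
`s` the velocity `γ'(s)` (exists and) lies in the horizontal space at `γ(s)`. -/
def IsHorizontalCurve (γ : ℝ → Space n) (a b : ℝ) : Prop :=
  AbsolutelyContinuousOnInterval γ a b ∧
    ∀ᵐ s ∂(volume.restrict (Icc a b)),
      DifferentiableAt ℝ γ s ∧ deriv γ s ∈ horizontalSpace (γ s)

/-- The sub-Riemannian length of a horizontal curve. -/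
def horizontalLength (γ : ℝ → Space n) (a b : ℝ) : ENNReal :=
  ∫⁻ s in Icc a b, ENNReal.ofReal (horizontalNorm (deriv γ s))

/-- The Carnot–Carathéodory distance: the infimum of the lengths of the horizontal curves
from `p` to `q`. -/
def ccEDist (p q : Space n) : ENNReal :=
  ⨅ (a : ℝ) (b : ℝ) (γ : ℝ → Space n)
    (_ : a ≤ b ∧ IsHorizontalCurve γ a b ∧ γ a = p ∧ γ b = q), horizontalLength γ a b

/-- `f` is locally Lipschitz on `E` as a map into `ℍ^n` with the Carnot–Carathéodory distance:
each point of `E` has a neighbourhood in `E` on which `f` is Lipschitz. -/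
def CCLocallyLipschitzOn {k : ℕ} (f : EuclideanSpace ℝ (Fin k) → Space n)
    (E : Set (EuclideanSpace ℝ (Fin k))) : Prop :=
  ∀ x ∈ E, ∃ C : NNReal, ∃ U ∈ 𝓝[E] x, ∀ y ∈ U, ∀ z ∈ U,
    ccEDist (f y) (f z) ≤ C * edist y z

/-- The orthogonal projection `π : ℝ^{2n+1} → ℝ^{2n}`, `π (x, y, t) = (x, y)`. -/
def proj (p : Space n) : Plane n := WithLp.toLp 2 fun i => p (Sum.inl i)

/-- The standard symplectic form `ω = ∑ dx_j ∧ dy_j` on `ℝ^{2n}`. -/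
def symplecticForm (v w : Plane n) : ℝ :=
  ∑ j, (v (Sum.inl j) * w (Sum.inr j) - v (Sum.inr j) * w (Sum.inl j))

/-- A subspace of `ℝ^{2n}` is isotropic if `ω` vanishes on it. -/
def IsIsotropic (V : Submodule ℝ (Plane n)) : Prop :=
  ∀ v ∈ V, ∀ w ∈ V, symplecticForm v w = 0

/-- `x` is a (Lebesgue) density point of `K`: the complement of `K` has density zero at `x`. -/
def IsDensityPoint {k : ℕ} (K : Set (EuclideanSpace ℝ (Fin k)))
    (x : EuclideanSpace ℝ (Fin k)) : Prop :=
  Tendsto (fun r : ℝ => volume (Metric.closedBall x r \ K) / volume (Metric.closedBall x r))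
    (𝓝[>] 0) (𝓝 0)

/-- The linear map `A` is the approximate derivative at `x` of the map `f`, regarded as a map
defined on `E` only: the approximate limit of `‖f y - f x - A (y - x)‖ / ‖y - x‖`, as `y → x`
in `E`, is zero. -/
def HasApproxFDerivAt {k : ℕ} {F : Type*} [NormedAddCommGroup F] [NormedSpace ℝ F]
    (f : EuclideanSpace ℝ (Fin k) → F) (E : Set (EuclideanSpace ℝ (Fin k)))
    (x : EuclideanSpace ℝ (Fin k)) (A : EuclideanSpace ℝ (Fin k) →L[ℝ] F) : Prop :=
  ∀ ε : ℝ, 0 < ε → IsDensityPoint {y ∈ E | ‖f y - f x - A (y - x)‖ ≤ ε * ‖y - x‖} x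

/-- If `f` agrees on `K ⊆ E` with a map `g` differentiable at a density point `x` of `K`, then the
derivative of `g` at `x` is the approximate derivative of `f` at `x`. -/
theorem HasApproxFDerivAt.of_eqOn {k : ℕ} {F : Type*} [NormedAddCommGroup F] [NormedSpace ℝ F]
    {f g : EuclideanSpace ℝ (Fin k) → F} {E K : Set (EuclideanSpace ℝ (Fin k))}
    {x : EuclideanSpace ℝ (Fin k)} {A : EuclideanSpace ℝ (Fin k) →L[ℝ] F}
    (hKE : K ⊆ E) (hfg : EqOn f g K) (hxK : x ∈ K) (hx : IsDensityPoint K x)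
    (hg : HasFDerivAt g A x) : HasApproxFDerivAt f E x A := by
  intro ε hε
  have h := hg.isLittleO.def hε
  obtain ⟨δ, hδ, hball⟩ := Metric.eventually_nhds_iff.1 h
  refine tendsto_of_tendsto_of_tendsto_of_le_of_le' tendsto_const_nhds hx
    (Eventually.of_forall fun _ => zero_le) ?_
  filter_upwards [Ioo_mem_nhdsGT hδ] with r hr
  refine ENNReal.div_le_div_right (measure_mono ?_) _
  rintro y ⟨hyr, hyG⟩
  refine ⟨hyr, fun hyK => hyG ⟨hKE hyK, ?_⟩⟩
  rw [hfg hyK, hfg hxK]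
  exact hball (lt_of_le_of_lt (Metric.mem_closedBall.1 hyr) hr.2)

end HeisenbergRank

end

open scoped NNReal

/-! A horizontal curve of length at most `L` moves its projection by at most `L` and has vertical
gap at most `2 * L ^ 2` between its ends. So a CC-Lipschitz map `f` satisfies `|verticalGap (f p) (f
q)| ≤ C * ‖q - p‖ ^ 2` locally. The gap is not additive: its defect on a triangle is `2ω` of two
projected sides (`verticalGap_sub_verticalGap`).

Dividing by `r ^ 2` near `x` and letting `r → 0` yields a function `T` with `|T w - T u + 2ω(B u, B
w)| ≤ C * ‖w - u‖ ^ 2`, where `B = ap d(π ∘ f)_x`. Then `T` has derivative `-2ω(B y, B ·)` at each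
`y`, and symmetry of its second derivative makes this alternating form vanish
(`eq_zero_of_abs_sub_add_le`): the image of `B` is isotropic, hence of dimension at most `n`. The
quadratic bound also makes `ap df_x` horizontal, and `π` is injective on horizontal vectors, so the
rank bound passes to `f`.

Both arguments work at every point of `E` where the derivative exists. Only existence is an
almost-everywhere statement, obtained from Rademacher's theorem. -/

namespace AbsolutelyContinuousOnInterval

/-! ### Absolutely continuous functions. -/

theorem lipschitz_comp {X Y : Type*} [PseudoMetricSpace X] [PseudoMetricSpace Y] {γ : ℝ → X}
    {φ : X → Y} {K : ℝ≥0} {a b : ℝ} (hφ : LipschitzWith K φ)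
    (hγ : AbsolutelyContinuousOnInterval γ a b) :
    AbsolutelyContinuousOnInterval (fun s => φ (γ s)) a b := by
  unfold AbsolutelyContinuousOnInterval at hγ ⊢
  refine squeeze_zero (fun _ => Finset.sum_nonneg fun _ _ => dist_nonneg) (fun I => ?_)
    (by simpa using hγ.const_mul (K : ℝ))
  rw [Finset.mul_sum]
  exact Finset.sum_le_sum fun _ _ => hφ.dist_le_mul _ _

/-- The increment of an absolutely continuous function is at most the integral of any bound for the
absolute value of its derivative. -/
theorem abs_sub_le_lintegral {h : ℝ → ℝ} {g : ℝ → ENNReal} {a b : ℝ} (hab : a ≤ b)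
    (hh : AbsolutelyContinuousOnInterval h a b)
    (hg : ∀ᵐ s ∂(volume.restrict (Icc a b)), ENNReal.ofReal |deriv h s| ≤ g s) :
    ENNReal.ofReal |h b - h a| ≤ ∫⁻ s in Icc a b, g s := by
  rw [← hh.integral_deriv_eq_sub, intervalIntegral.integral_of_le hab,
    ← integral_Icc_eq_integral_Ioc, ← Real.enorm_eq_ofReal_abs]
  refine (enorm_integral_le_lintegral_enorm _).trans (lintegral_mono_ae ?_)
  simpa only [Real.enorm_eq_ofReal_abs] using hg

end AbsolutelyContinuousOnInterval

namespace HeisenbergRank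

variable {n k : ℕ}

/-! ### Linear algebra of `ω` and of the contact form. -/

/-- The projection `π` as a continuous linear map. -/
noncomputable def projL (n : ℕ) : Space n →L[ℝ] Plane n :=
  LinearMap.toContinuousLinearMap
    { toFun := proj
      map_add' := fun _ _ => rfl
      map_smul' := fun _ _ => rfl }

@[simp] theorem projL_apply (p : Space n) : projL n p = proj p := rfl

/-- The coordinate `t` as a continuous linear map. -/
noncomputable def heightL (n : ℕ) : Space n →L[ℝ] ℝ := EuclideanSpace.proj (Sum.inr ())

theorem norm_proj_eq_horizontalNorm (v : Space n) : ‖proj v‖ = horizontalNorm v := by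
  simp [EuclideanSpace.norm_eq, horizontalNorm, proj, xc, yc, Finset.sum_add_distrib]

theorem norm_sq_eq (v : Space n) : ‖v‖ ^ 2 = ‖proj v‖ ^ 2 + heightL n v ^ 2 := by
  simp [EuclideanSpace.norm_sq_eq, proj, heightL]

theorem norm_le_proj_add_height (v : Space n) : ‖v‖ ≤ ‖proj v‖ + |heightL n v| := by
  refine abs_le_of_sq_le_sq' ?_ (by positivity) |>.2
  rw [norm_sq_eq, ← sq_abs (heightL n v)]
  nlinarith [mul_nonneg (norm_nonneg (proj v)) (abs_nonneg (heightL n v))]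

/-- The standard complex structure on `ℝ^{2n}`, `(x, y) ↦ (-y, x)`. -/
noncomputable def complexStructure (n : ℕ) : Plane n →ₗᵢ[ℝ] Plane n where
  toFun v := WithLp.toLp 2 (Sum.elim (fun j => -v (Sum.inr j)) fun j => v (Sum.inl j))
  map_add' v w := by
    ext i
    rcases i with i | i <;> simp [add_comm]
  map_smul' c v := by
    ext i
    rcases i with i | i <;> simp
  norm_map' v := by
    simp [EuclideanSpace.norm_eq, add_comm]

theorem symplecticForm_eq_inner (v w : Plane n) :
    symplecticForm v w = inner ℝ (complexStructure n v) w := by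
  simp [symplecticForm, complexStructure, PiLp.inner_apply, Finset.sum_sub_distrib, mul_comm]
  ring

/-- The symplectic form as a continuous bilinear map. -/
noncomputable def symplecticL (n : ℕ) : Plane n →L[ℝ] Plane n →L[ℝ] ℝ :=
  (innerSL ℝ).comp (complexStructure n).toContinuousLinearMap

theorem symplecticL_apply (v w : Plane n) : symplecticL n v w = symplecticForm v w := by
  simp [symplecticForm_eq_inner, symplecticL]

theorem abs_symplecticL_le (v w : Plane n) : |symplecticL n v w| ≤ ‖v‖ * ‖w‖ := by
  rw [symplecticL_apply, symplecticForm_eq_inner]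
  simpa using abs_real_inner_le_norm (complexStructure n v) w

theorem symplecticL_self (v : Plane n) : symplecticL n v v = 0 := by
  rw [symplecticL_apply]
  exact Finset.sum_eq_zero fun _ _ => by ring

theorem symplecticL_swap (v w : Plane n) : symplecticL n w v = -symplecticL n v w := by
  simp only [symplecticL_apply, symplecticForm, ← Finset.sum_neg_distrib]
  exact Finset.sum_congr rfl fun _ _ => by ring

/-- Isotropy says that the complex structure maps `V` injectively into `Vᗮ`, so twice the dimension
of `V` is at most `2n`. -/
theorem finrank_le_of_isIsotropic {V : Submodule ℝ (Plane n)} (hV : IsIsotropic V) :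
    Module.finrank ℝ V ≤ n := by
  have hle : V.map (complexStructure n).toLinearMap ≤ Vᗮ := by
    rintro _ ⟨v, hv, rfl⟩
    rw [Submodule.mem_orthogonal']
    intro w hw
    exact (symplecticForm_eq_inner v w).symm.trans (hV v hv w hw)
  have h1 := Submodule.finrank_mono hle
  rw [← (Submodule.equivMapOfInjective _ (complexStructure n).injective V).finrank_eq] at h1
  have h2 := V.finrank_add_finrank_orthogonal
  simp at h2
  omega

/-- Horizontal vectors are in the kernel of the contact form. -/
theorem heightL_of_mem_horizontalSpace {p v : Space n} (hv : v ∈ horizontalSpace p) :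
    heightL n v = -2 * symplecticL n (proj p) (proj v) := by
  let φ : Space n →L[ℝ] ℝ := heightL n + (2 : ℝ) • (symplecticL n (proj p)).comp (projL n)
  suffices h : horizontalSpace p ≤ φ.toLinearMap.ker by
    have := h hv
    simp [φ] at this
    linarith
  rw [horizontalSpace, Submodule.span_le]
  rintro _ (⟨j, rfl⟩ | ⟨j, rfl⟩) <;>
    simp [φ, heightL, symplecticL_apply, symplecticForm, proj, fieldX, fieldY, dx, dy, dt, xc, yc]

/-! ### Length bounds for the projection and the vertical gap. -/

/-- The vertical coordinate of `p⁻¹ q` in the Heisenberg group. -/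
noncomputable def verticalGap (p q : Space n) : ℝ :=
  heightL n q - heightL n p + 2 * symplecticL n (proj p) (proj q)

theorem norm_proj_sub_le_horizontalLength {γ : ℝ → Space n} {a b : ℝ} (hab : a ≤ b)
    (hγ : IsHorizontalCurve γ a b) :
    ENNReal.ofReal ‖proj (γ b) - proj (γ a)‖ ≤ horizontalLength γ a b := by
  obtain ⟨hac, hd⟩ := hγ
  set w := proj (γ b) - proj (γ a) with hw
  rcases eq_or_ne w 0 with h0 | h0
  · simp [h0]
  -- Pairing with the unit vector along `w` reduces the claim to a scalar function.
  set u : Plane n := (‖w‖)⁻¹ • w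
  have hu : ‖u‖ = 1 := by simp [u, norm_smul, h0]
  let φ : Space n →L[ℝ] ℝ := (innerSL ℝ u).comp (projL n)
  have key := (hac.lipschitz_comp φ.lipschitz).abs_sub_le_lintegral (g := fun s =>
    ENNReal.ofReal (horizontalNorm (deriv γ s))) hab (by
      filter_upwards [hd] with s hs
      rw [HasDerivAt.deriv (f := fun s => φ (γ s))
        (φ.hasFDerivAt.comp_hasDerivAt s hs.1.hasDerivAt)]
      refine ENNReal.ofReal_le_ofReal ?_
      rw [← norm_proj_eq_horizontalNorm]
      simpa [φ, hu] using abs_real_inner_le_norm u (proj (deriv γ s)))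
  refine le_trans (ENNReal.ofReal_le_ofReal ?_) key
  rw [← map_sub]
  have : φ (γ b - γ a) = ‖w‖ := by
    have : φ (γ b - γ a) = inner ℝ u w := rfl
    rw [this, inner_smul_left, real_inner_self_eq_norm_sq]
    have := norm_ne_zero_iff.2 h0
    simp
    field_simp
  rw [this, abs_norm]

theorem IsHorizontalCurve.mono_right {γ : ℝ → Space n} {a b c : ℝ} (hac : a ≤ c) (hcb : c ≤ b)
    (hγ : IsHorizontalCurve γ a b) : IsHorizontalCurve γ a c :=
  ⟨hγ.1.mono (by
      rw [uIcc_of_le hac, uIcc_of_le (hac.trans hcb)]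
      exact Icc_subset_Icc_right hcb),
    ae_restrict_of_ae_restrict_of_subset (Icc_subset_Icc_right hcb) hγ.2⟩

/-- Along `γ` the gap from `γ a` has derivative `-2ω(πγ - πγ(a), πγ')`, and the first argument stays
within `L` of zero. Integrating gives `2L` times the length. -/
theorem abs_verticalGap_le_of_horizontalLength_le {γ : ℝ → Space n} {a b L : ℝ} (hab : a ≤ b)
    (hL : 0 ≤ L) (hγ : IsHorizontalCurve γ a b)
    (hlen : horizontalLength γ a b ≤ ENNReal.ofReal L) :
    |verticalGap (γ a) (γ b)| ≤ 2 * L ^ 2 := by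
  let φ : Space n →L[ℝ] ℝ :=
    heightL n + (2 : ℝ) • (symplecticL n (proj (γ a))).comp (projL n)
  have hnear : ∀ s ∈ Icc a b, ‖proj (γ s) - proj (γ a)‖ ≤ L := by
    intro s hs
    refine (ENNReal.ofReal_le_ofReal_iff hL).1 ?_
    refine (norm_proj_sub_le_horizontalLength hs.1 (hγ.mono_right hs.1 hs.2)).trans
      (le_trans ?_ hlen)
    exact lintegral_mono_set (Icc_subset_Icc_right hs.2)
  have key := (hγ.1.lipschitz_comp φ.lipschitz).abs_sub_le_lintegral (g := fun s =>
    ENNReal.ofReal (2 * L) * ENNReal.ofReal (horizontalNorm (deriv γ s))) hab (by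
      filter_upwards [hγ.2, ae_restrict_mem measurableSet_Icc] with s hs hsI
      rw [HasDerivAt.deriv (f := fun s => φ (γ s))
        (φ.hasFDerivAt.comp_hasDerivAt s hs.1.hasDerivAt),
        ← ENNReal.ofReal_mul (by positivity)]
      refine ENNReal.ofReal_le_ofReal ?_
      have h1 : φ (deriv γ s)
          = -2 * symplecticL n (proj (γ s) - proj (γ a)) (proj (deriv γ s)) := by
        have := heightL_of_mem_horizontalSpace hs.2
        simp only [φ, add_apply, smul_apply, this,
          ContinuousLinearMap.comp_apply, projL_apply, map_sub, sub_apply,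
          smul_eq_mul]
        ring
      rw [h1, abs_mul, ← norm_proj_eq_horizontalNorm]
      have h2 := abs_symplecticL_le (proj (γ s) - proj (γ a)) (proj (deriv γ s))
      have h3 := mul_le_mul_of_nonneg_right (hnear s hsI) (norm_nonneg (proj (deriv γ s)))
      rw [abs_neg, abs_two]
      linarith)
  rw [lintegral_const_mul' _ _ ENNReal.ofReal_ne_top] at key
  have h4 := key.trans (mul_le_mul_right hlen _)
  rw [← ENNReal.ofReal_mul (by positivity), ENNReal.ofReal_le_ofReal_iff (by positivity)] at h4
  have h5 : verticalGap (γ a) (γ b) = φ (γ b) - φ (γ a) := by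
    simp [φ, verticalGap, symplecticL_self]
    ring
  rw [h5]
  linarith

/-- The infimum need not be attained, so curves of length below each `M > L` are used and then `M`
decreases to `L`. -/
theorem bounds_of_ccEDist_le {p q : Space n} {L : ℝ} (hL : 0 ≤ L)
    (h : ccEDist p q ≤ ENNReal.ofReal L) :
    ‖proj q - proj p‖ ≤ L ∧ |verticalGap p q| ≤ 2 * L ^ 2 := by
  have key : ∀ M, L < M → ‖proj q - proj p‖ ≤ M ∧ |verticalGap p q| ≤ 2 * M ^ 2 := by
    intro M hM
    have hM0 : 0 < M := hL.trans_lt hM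
    have hlt := h.trans_lt ((ENNReal.ofReal_lt_ofReal_iff hM0).2 hM)
    simp only [ccEDist, iInf_lt_iff] at hlt
    obtain ⟨a, b, γ, ⟨hab, hγ, rfl, rfl⟩, hlen⟩ := hlt
    exact ⟨(ENNReal.ofReal_le_ofReal_iff hM0.le).1
      ((norm_proj_sub_le_horizontalLength hab hγ).trans hlen.le),
      abs_verticalGap_le_of_horizontalLength_le hab hM0.le hγ hlen.le⟩
  refine ⟨le_of_forall_gt_imp_ge_of_dense fun M hM => (key M hM).1, ?_⟩
  have hc : Tendsto (fun M : ℝ => 2 * M ^ 2) (𝓝[>] L) (𝓝 (2 * L ^ 2)) :=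
    ((continuous_const.mul (continuous_pow 2)).tendsto L).mono_left nhdsWithin_le_nhds
  exact ge_of_tendsto hc (eventually_nhdsWithin_of_forall fun M hM => (key M hM).2)

theorem proj_sub (p q : Space n) : proj (p - q) = proj p - proj q := rfl

/-! ### Approximate derivatives along selected points. -/

/-- A set of full density at `x` meets the ball of radius `δ r` around `x + r u` when `r` is
small. -/
theorem IsDensityPoint.eventually_exists_mem {G : Set (EuclideanSpace ℝ (Fin k))}
    {x : EuclideanSpace ℝ (Fin k)} (hG : IsDensityPoint G x) (u : EuclideanSpace ℝ (Fin k))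
    {δ : ℝ} (hδ : 0 < δ) :
    ∀ᶠ r : ℝ in 𝓝[>] 0, ∃ p ∈ G, ‖p - (x + r • u)‖ ≤ δ * r := by
  set R := ‖u‖ + δ
  have hR : 0 < R := by positivity
  have hscale : Tendsto (fun r : ℝ => R * r) (𝓝[>] 0) (𝓝[>] 0) := by
    refine tendsto_nhdsWithin_iff.2 ⟨?_, ?_⟩
    · simpa using ((continuous_const_mul R).tendsto 0).mono_left nhdsWithin_le_nhds
    · filter_upwards [self_mem_nhdsWithin] with r hr using mul_pos hR hr
  have hpos : (0 : ENNReal) < ENNReal.ofReal ((δ / R) ^ k) :=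
    ENNReal.ofReal_pos.2 (by positivity)
  filter_upwards [(hG.comp hscale).eventually_lt_const hpos, self_mem_nhdsWithin] with r hr hr0
  by_contra! hcon
  have hr0 : 0 < r := hr0
  -- If `G` missed the small ball, its complement would fill the fixed fraction `(δ / R) ^ k` of the
  -- ball of radius `R * r`.
  have hsub : Metric.closedBall (x + r • u) (δ * r) ⊆ Metric.closedBall x (R * r) \ G := by
    intro p hp
    rw [Metric.mem_closedBall, dist_eq_norm] at hp
    refine ⟨?_, fun hpG => (hcon p hpG).not_ge hp⟩
    rw [Metric.mem_closedBall, dist_eq_norm]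
    calc ‖p - x‖ = ‖(p - (x + r • u)) + r • u‖ := by congr 1; abel
      _ ≤ δ * r + r * ‖u‖ := by
          refine (norm_add_le _ _).trans (add_le_add hp ?_)
          rw [norm_smul, Real.norm_of_nonneg hr0.le]
      _ = R * r := by ring
  have hvol : volume (Metric.closedBall (x + r • u) (δ * r))
      = ENNReal.ofReal ((δ / R) ^ k) * volume (Metric.closedBall x (R * r)) := by
    have h1 : δ * r = (δ / R) * (R * r) := by field_simp
    rw [h1, Measure.addHaar_closedBall_mul _ _ (by positivity) (by positivity),
      Measure.addHaar_closedBall_center _ x]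
    simp
  have hB0 : volume (Metric.closedBall x (R * r)) ≠ 0 :=
    (Metric.measure_closedBall_pos _ _ (by positivity)).ne'
  have hBt : volume (Metric.closedBall x (R * r)) ≠ ⊤ := measure_closedBall_lt_top.ne
  refine hr.not_ge ?_
  rw [Function.comp_apply, ENNReal.le_div_iff_mul_le (Or.inl hB0) (Or.inl hBt), ← hvol]
  exact measure_mono hsub

/-- Along well-chosen points of `E` near `x + r u`, difference quotients of a map at `x` converge to
its approximate derivative in the direction `u`. -/
theorem HasApproxFDerivAt.exists_tendsto {F : Type*} [NormedAddCommGroup F] [NormedSpace ℝ F]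
    {f : EuclideanSpace ℝ (Fin k) → F} {E : Set (EuclideanSpace ℝ (Fin k))}
    {x : EuclideanSpace ℝ (Fin k)} {A : EuclideanSpace ℝ (Fin k) →L[ℝ] F}
    (hx : x ∈ E) (h : HasApproxFDerivAt f E x A) (u : EuclideanSpace ℝ (Fin k)) :
    ∃ P : ℝ → EuclideanSpace ℝ (Fin k), (∀ r, P r ∈ E) ∧
      Tendsto (fun r => r⁻¹ • (P r - x)) (𝓝[>] 0) (𝓝 u) ∧
      Tendsto (fun r => r⁻¹ • (f (P r) - f x)) (𝓝[>] 0) (𝓝 (A u)) := by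
  let err : ℝ → EuclideanSpace ℝ (Fin k) → ℝ := fun r p =>
    ‖r⁻¹ • (p - x) - u‖ + ‖r⁻¹ • (f p - f x) - A u‖
  have herr0 : ∀ r p, 0 ≤ err r p := fun r p => by positivity
  have hsmall : ∀ ε > 0, ∀ᶠ r : ℝ in 𝓝[>] 0, ∃ p ∈ E, err r p < ε := by
    intro ε hε
    obtain ⟨δ, hδ, hδ1, hδε⟩ : ∃ δ : ℝ, 0 < δ ∧ δ ≤ 1 ∧ δ * (2 + ‖A‖ + ‖u‖) < ε := by
      refine ⟨min 1 (ε / 2 / (2 + ‖A‖ + ‖u‖)), by positivity, min_le_left _ _, ?_⟩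
      refine (mul_le_mul_of_nonneg_right (min_le_right _ _) (by positivity)).trans_lt ?_
      rw [div_mul_cancel₀ _ (by positivity)]
      linarith
    filter_upwards [(h δ hδ).eventually_exists_mem u hδ, self_mem_nhdsWithin]
      with r ⟨p, ⟨hpE, hp⟩, hpu⟩ hr0
    have hr0 : 0 < r := hr0
    refine ⟨p, hpE, ?_⟩
    have h1 : ‖r⁻¹ • (p - x) - u‖ ≤ δ := by
      have : r⁻¹ • (p - x) - u = r⁻¹ • (p - (x + r • u)) := by
        rw [← sub_sub, smul_sub _ (p - x), smul_smul, inv_mul_cancel₀ hr0.ne', one_smul]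
      rw [this, norm_smul, norm_inv, Real.norm_of_nonneg hr0.le, inv_mul_le_iff₀ hr0]
      linarith
    have h2 : ‖r⁻¹ • (p - x)‖ ≤ 1 + ‖u‖ := by
      have := norm_add_le (r⁻¹ • (p - x) - u) u
      rw [sub_add_cancel] at this
      linarith
    have h3 : ‖r⁻¹ • (f p - f x - A (p - x))‖ ≤ δ * (1 + ‖u‖) := by
      rw [norm_smul] at h2 ⊢
      calc ‖r⁻¹‖ * ‖f p - f x - A (p - x)‖ ≤ ‖r⁻¹‖ * (δ * ‖p - x‖) := by gcongr
        _ = δ * (‖r⁻¹‖ * ‖p - x‖) := by ring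
        _ ≤ δ * (1 + ‖u‖) := by gcongr
    have h4 : r⁻¹ • (f p - f x) - A u
        = r⁻¹ • (f p - f x - A (p - x)) + A (r⁻¹ • (p - x) - u) := by
      rw [smul_sub _ (f p - f x), map_sub A (r⁻¹ • (p - x)), map_smul]
      abel
    have h5 : ‖A (r⁻¹ • (p - x) - u)‖ ≤ ‖A‖ * δ :=
      (A.le_opNorm _).trans (by gcongr)
    have h6 : ‖r⁻¹ • (f p - f x) - A u‖ ≤ δ * (1 + ‖u‖) + ‖A‖ * δ := by
      rw [h4]
      exact (norm_add_le _ _).trans (add_le_add h3 h5)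
    calc err r p ≤ δ + (δ * (1 + ‖u‖) + ‖A‖ * δ) := add_le_add h1 h6
      _ = δ * (2 + ‖A‖ + ‖u‖) := by ring
      _ < ε := hδε
  -- Choosing a minimiser of the error up to `r` gives one selection that serves all `ε` at once;
  -- for `r ≤ 0` any point of `E` will do.
  have hchoice : ∀ r : ℝ, ∃ p ∈ E, 0 < r → err r p < sInf (err r '' E) + r := by
    intro r
    by_cases hr : 0 < r
    · obtain ⟨_, ⟨p, hp, rfl⟩, hlt⟩ := Real.lt_sInf_add_pos (Set.Nonempty.image (err r) ⟨x, hx⟩) hr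
      exact ⟨p, hp, fun _ => hlt⟩
    · exact ⟨x, hx, fun h => absurd h hr⟩
  choose P hPE hP using hchoice
  have hlim : Tendsto (fun r => err r (P r)) (𝓝[>] 0) (𝓝 0) := by
    rw [Metric.tendsto_nhds]
    intro ε hε
    filter_upwards [hsmall (ε / 2) (half_pos hε), Ioo_mem_nhdsGT (half_pos hε)]
      with r ⟨p, hp, hlt⟩ hr
    rw [Real.dist_0_eq_abs, abs_of_nonneg (herr0 _ _)]
    have h1 : sInf (err r '' E) ≤ err r p :=
      csInf_le ⟨0, by rintro _ ⟨q, -, rfl⟩; exact herr0 r q⟩ (mem_image_of_mem _ hp)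
    linarith [hP r hr.1, hr.2]
  refine ⟨P, hPE, ?_, ?_⟩
  · rw [tendsto_iff_norm_sub_tendsto_zero]
    exact squeeze_zero (fun _ => norm_nonneg _)
      (fun r => le_add_of_nonneg_right (norm_nonneg _)) hlim
  · rw [tendsto_iff_norm_sub_tendsto_zero]
    exact squeeze_zero (fun _ => norm_nonneg _)
      (fun r => le_add_of_nonneg_left (norm_nonneg _)) hlim

/-! ### Blow-up and isotropy. -/

/-- An alternating continuous bilinear form vanishes if it is a coboundary up to a quadratic error. -/
theorem eq_zero_of_abs_sub_add_le {V : Type*} [NormedAddCommGroup V] [NormedSpace ℝ V]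
    {Ω : V →L[ℝ] V →L[ℝ] ℝ} (hΩ : ∀ v, Ω v v = 0) {T : V → ℝ} {C : ℝ}
    (h : ∀ u w, |T w - T u + Ω u w| ≤ C * ‖w - u‖ ^ 2) (u w : V) : Ω u w = 0 := by
  have hderiv : ∀ y, HasFDerivAt T ((-Ω) y) y := by
    intro y
    refine HasFDerivAt.of_isLittleO ?_
    have hO : (fun z => T z - T y - (-Ω) y (z - y)) =O[𝓝 y] fun z => ‖z - y‖ ^ 2 := by
      refine Asymptotics.IsBigO.of_bound C (Eventually.of_forall fun z => ?_)
      have : T z - T y - (-Ω) y (z - y) = T z - T y + Ω y z := by simp [hΩ]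
      rw [this, Real.norm_eq_abs, norm_pow, norm_norm]
      exact h y z
    refine hO.trans_isLittleO ?_
    simpa using Asymptotics.isLittleO_pow_sub_sub y (one_lt_two)
  -- The derivative `y ↦ -Ω y` is linear, hence its own derivative. The form is thus both symmetric
  -- and alternating.
  have hsymm := second_derivative_symmetric hderiv ((-Ω).hasFDerivAt (x := 0)) u w
  have hadd := hΩ (u + w)
  simp [hΩ] at hsymm hadd
  linarith

theorem exists_tendsto_ultrafilter {α : Type*} (l : Ultrafilter α) {g : α → ℝ} {M : ℝ}
    (h : ∀ᶠ r in (l : Filter α), |g r| ≤ M) : ∃ a, Tendsto g l (𝓝 a) := by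
  obtain ⟨a, -, ha⟩ := (isCompact_Icc (a := -M) (b := M)).ultrafilter_le_nhds (l.map g)
    (le_principal_iff.2 (h.mono fun r hr => abs_le.1 hr))
  exact ⟨a, ha⟩

/-- The local estimate enjoyed by maps that are Lipschitz into the Heisenberg group. -/
def GapBoundNear (f : EuclideanSpace ℝ (Fin k) → Space n) (E : Set (EuclideanSpace ℝ (Fin k)))
    (x : EuclideanSpace ℝ (Fin k)) (C : ℝ) : Prop :=
  ∃ U ∈ 𝓝 x, ∀ p ∈ U ∩ E, ∀ q ∈ U ∩ E, |verticalGap (f p) (f q)| ≤ C * ‖q - p‖ ^ 2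

theorem verticalGap_sub_verticalGap (o p q : Space n) :
    verticalGap p q = verticalGap o q - verticalGap o p
      + 2 * symplecticL n (proj p - proj o) (proj q - proj o) := by
  simp only [verticalGap, map_sub, sub_apply, symplecticL_self,
    symplecticL_swap (proj o) (proj p)]
  ring

theorem tendsto_of_tendsto_inv_smul_sub {V : Type*} [NormedAddCommGroup V] [NormedSpace ℝ V]
    {P : ℝ → V} {x u : V} (h : Tendsto (fun r : ℝ => r⁻¹ • (P r - x)) (𝓝[>] 0) (𝓝 u)) :
    Tendsto P (𝓝[>] 0) (𝓝 x) := by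
  have h0 : Tendsto (fun r : ℝ => r) (𝓝[>] 0) (𝓝 0) := tendsto_id.mono_left nhdsWithin_le_nhds
  have h1 := (h0.smul h).add_const x
  rw [zero_smul, zero_add] at h1
  refine h1.congr' ?_
  filter_upwards [self_mem_nhdsWithin] with r (hr : 0 < r)
  rw [smul_smul, mul_inv_cancel₀ hr.ne', one_smul, sub_add_cancel]

/-- `τ` is the gap from `f x` at scale `r ^ 2` and `ζ` the projected increment at scale `r`, the
homogeneous scaling of the Heisenberg group. -/
theorem isIsotropic_range_of_gapBoundNear {f : EuclideanSpace ℝ (Fin k) → Space n}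
    {E : Set (EuclideanSpace ℝ (Fin k))} {x : EuclideanSpace ℝ (Fin k)} {C : ℝ}
    {B : EuclideanSpace ℝ (Fin k) →L[ℝ] Plane n} (hx : x ∈ E) (hf : GapBoundNear f E x C)
    (hB : HasApproxFDerivAt (fun y => proj (f y)) E x B) :
    IsIsotropic (LinearMap.range B.toLinearMap) := by
  obtain ⟨U, hU, hgap⟩ := hf
  choose P hPE hPu hPB using fun u => hB.exists_tendsto hx u
  have hPU : ∀ u, ∀ᶠ r in 𝓝[>] (0 : ℝ), P u r ∈ U ∩ E := fun u =>
    ((tendsto_of_tendsto_inv_smul_sub (hPu u)).eventually hU).mono fun r hr => ⟨hr, hPE u r⟩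
  let τ : EuclideanSpace ℝ (Fin k) → ℝ → ℝ := fun u r => (r ^ 2)⁻¹ * verticalGap (f x) (f (P u r))
  let ζ : EuclideanSpace ℝ (Fin k) → ℝ → Plane n := fun u r =>
    r⁻¹ • (proj (f (P u r)) - proj (f x))
  have hest : ∀ u w, ∀ᶠ r in 𝓝[>] (0 : ℝ),
      |τ w r - τ u r + 2 * symplecticL n (ζ u r) (ζ w r)|
        ≤ C * ‖r⁻¹ • (P w r - x) - r⁻¹ • (P u r - x)‖ ^ 2 := by
    intro u w
    filter_upwards [hPU u, hPU w, self_mem_nhdsWithin] with r hu hw (hr : 0 < r)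
    have h1 : τ w r - τ u r + 2 * symplecticL n (ζ u r) (ζ w r)
        = (r ^ 2)⁻¹ * verticalGap (f (P u r)) (f (P w r)) := by
      rw [verticalGap_sub_verticalGap (f x)]
      simp only [τ, ζ, map_smul, smul_apply, smul_eq_mul]
      field_simp
    rw [h1, ← smul_sub, sub_sub_sub_cancel_right, norm_smul, mul_pow, norm_inv,
      Real.norm_of_nonneg hr.le, abs_mul, abs_of_nonneg (by positivity), inv_pow]
    calc (r ^ 2)⁻¹ * |verticalGap (f (P u r)) (f (P w r))|
        ≤ (r ^ 2)⁻¹ * (C * ‖P w r - P u r‖ ^ 2) := by gcongr; exact hgap _ hu _ hw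
      _ = _ := by ring
  have hbound : ∀ u w, Tendsto (fun r => C * ‖r⁻¹ • (P w r - x) - r⁻¹ • (P u r - x)‖ ^ 2)
      (𝓝[>] 0) (𝓝 (C * ‖w - u‖ ^ 2)) := fun u w =>
    (((hPu w).sub (hPu u)).norm.pow 2).const_mul C
  have hω : ∀ u w, Tendsto (fun r => 2 * symplecticL n (ζ u r) (ζ w r)) (𝓝[>] 0)
      (𝓝 (2 * symplecticL n (B u) (B w))) := fun u w =>
    (((symplecticL n).continuous₂.tendsto (B u, B w)).comp
      ((hPB u).prodMk_nhds (hPB w))).const_mul 2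
  -- The differences of `τ` are only known to be bounded. An ultrafilter makes them converge for all
  -- `u` simultaneously, without extracting subsequences.
  let l : Ultrafilter ℝ := Ultrafilter.of (𝓝[>] 0)
  have hl : (l : Filter ℝ) ≤ 𝓝[>] 0 := Ultrafilter.of_le _
  have hT : ∀ u, ∃ a, Tendsto (fun r => τ u r - τ 0 r) l (𝓝 a) := by
    intro u
    refine exists_tendsto_ultrafilter l
      (M := (C * ‖u - 0‖ ^ 2 + 1) + (|2 * symplecticL n (B 0) (B u)| + 1)) (hl ?_)
    filter_upwards [hest 0 u, (hbound 0 u).eventually_le_const (lt_add_one _),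
      (hω 0 u).abs.eventually_le_const (lt_add_one _)] with r h1 h2 h3
    calc |τ u r - τ 0 r|
        = |(τ u r - τ 0 r + 2 * symplecticL n (ζ 0 r) (ζ u r))
            - 2 * symplecticL n (ζ 0 r) (ζ u r)| := by rw [add_sub_cancel_right]
      _ ≤ _ := (abs_sub _ _).trans (add_le_add (h1.trans h2) h3)
  choose T hT using hT
  have hfinal : ∀ u w, |T w - T u + 2 * symplecticL n (B u) (B w)| ≤ C * ‖w - u‖ ^ 2 := by
    intro u w
    refine le_of_tendsto_of_tendsto ((((hT w).sub (hT u)).add ((hω u w).mono_left hl)).abs)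
      ((hbound u w).mono_left hl) (hl ?_)
    filter_upwards [hest u w] with r hr
    simpa using hr
  let Ω : EuclideanSpace ℝ (Fin k) →L[ℝ] EuclideanSpace ℝ (Fin k) →L[ℝ] ℝ :=
    (2 : ℝ) • (symplecticL n).bilinearComp B B
  have hzero := eq_zero_of_abs_sub_add_le (Ω := Ω) (T := T) (C := C)
    (fun v => by simp [Ω, symplecticL_self]) (fun u w => by simpa [Ω] using hfinal u w)
  rintro _ ⟨u, rfl⟩ _ ⟨w, rfl⟩
  simpa [Ω, symplecticL_apply] using hzero u w

/-! ### Horizontality and the rank bound. -/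

/-- An approximate derivative of `f` takes values in the horizontal space. -/
theorem heightL_apply_of_gapBoundNear {f : EuclideanSpace ℝ (Fin k) → Space n}
    {E : Set (EuclideanSpace ℝ (Fin k))} {x : EuclideanSpace ℝ (Fin k)} {C : ℝ}
    {A : EuclideanSpace ℝ (Fin k) →L[ℝ] Space n} (hx : x ∈ E) (hf : GapBoundNear f E x C)
    (hA : HasApproxFDerivAt f E x A) (u : EuclideanSpace ℝ (Fin k)) :
    heightL n (A u) = -2 * symplecticL n (proj (f x)) (proj (A u)) := by
  obtain ⟨U, hU, hgap⟩ := hf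
  obtain ⟨P, hPE, hPu, hPA⟩ := hA.exists_tendsto hx u
  let φ : Space n →L[ℝ] ℝ := heightL n + (2 : ℝ) • (symplecticL n (proj (f x))).comp (projL n)
  have h1 : Tendsto (fun r => φ (r⁻¹ • (f (P r) - f x))) (𝓝[>] 0) (𝓝 (φ (A u))) :=
    (φ.continuous.tendsto _).comp hPA
  have h0 : Tendsto (fun r : ℝ => r) (𝓝[>] 0) (𝓝 0) := tendsto_id.mono_left nhdsWithin_le_nhds
  -- The increment of `φ` is the vertical gap, of order `r ^ 2`, so dividing by `r` leaves zero.
  have h2 : Tendsto (fun r => φ (r⁻¹ • (f (P r) - f x))) (𝓝[>] 0) (𝓝 0) := by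
    have h3 : Tendsto (fun r : ℝ => r * (C * ‖r⁻¹ • (P r - x)‖ ^ 2)) (𝓝[>] 0) (𝓝 0) := by
      simpa using h0.mul ((hPu.norm.pow 2).const_mul C)
    refine squeeze_zero_norm' ?_ h3
    filter_upwards [(tendsto_of_tendsto_inv_smul_sub hPu).eventually hU, self_mem_nhdsWithin]
      with r hr (hr0 : 0 < r)
    have h4 : φ (f (P r) - f x) = verticalGap (f x) (f (P r)) := by
      simp [φ, verticalGap, symplecticL_self, proj_sub]
    rw [map_smul, h4, norm_smul, norm_smul, mul_pow, norm_inv, Real.norm_of_nonneg hr0.le,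
      Real.norm_eq_abs]
    calc r⁻¹ * |verticalGap (f x) (f (P r))| ≤ r⁻¹ * (C * ‖P r - x‖ ^ 2) := by
          gcongr
          exact hgap _ ⟨mem_of_mem_nhds hU, hx⟩ _ ⟨hr, hPE r⟩
      _ = _ := by field_simp
  have h5 := tendsto_nhds_unique h1 h2
  simp [φ] at h5
  linarith

theorem HasApproxFDerivAt.clm_comp {F G : Type*} [NormedAddCommGroup F] [NormedSpace ℝ F]
    [NormedAddCommGroup G] [NormedSpace ℝ G] {f : EuclideanSpace ℝ (Fin k) → F}
    {E : Set (EuclideanSpace ℝ (Fin k))} {x : EuclideanSpace ℝ (Fin k)}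
    {A : EuclideanSpace ℝ (Fin k) →L[ℝ] F} (L : F →L[ℝ] G) (h : HasApproxFDerivAt f E x A) :
    HasApproxFDerivAt (fun y => L (f y)) E x (L.comp A) := by
  intro ε hε
  have hL : 0 < ‖L‖ + 1 := by positivity
  refine tendsto_of_tendsto_of_tendsto_of_le_of_le tendsto_const_nhds (h (ε / (‖L‖ + 1))
    (by positivity)) (fun _ => zero_le) fun r => ?_
  refine ENNReal.div_le_div_right (measure_mono (sdiff_subset_sdiff_right ?_)) _
  rintro y ⟨hyE, hy⟩
  refine ⟨hyE, ?_⟩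
  calc ‖L (f y) - L (f x) - L.comp A (y - x)‖ = ‖L (f y - f x - A (y - x))‖ := by simp
    _ ≤ (‖L‖ + 1) * ‖f y - f x - A (y - x)‖ :=
        (L.le_opNorm _).trans (by gcongr; linarith)
    _ ≤ (‖L‖ + 1) * (ε / (‖L‖ + 1) * ‖y - x‖) := by gcongr
    _ = ε * ‖y - x‖ := by field_simp

/-- A vector in the range of `A` with zero projection has zero height by horizontality, so the
projection embeds this range in an isotropic subspace. -/
theorem finrank_range_le_of_gapBoundNear {f : EuclideanSpace ℝ (Fin k) → Space n}
    {E : Set (EuclideanSpace ℝ (Fin k))} {x : EuclideanSpace ℝ (Fin k)} {C : ℝ}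
    {A : EuclideanSpace ℝ (Fin k) →L[ℝ] Space n} (hx : x ∈ E) (hf : GapBoundNear f E x C)
    (hA : HasApproxFDerivAt f E x A) :
    Module.finrank ℝ (LinearMap.range A.toLinearMap) ≤ n := by
  have hiso := isIsotropic_range_of_gapBoundNear hx hf (hA.clm_comp (projL n))
  refine le_trans ?_ (finrank_le_of_isIsotropic hiso)
  let g : LinearMap.range A.toLinearMap →ₗ[ℝ] LinearMap.range ((projL n).comp A).toLinearMap :=
    (projL n).toLinearMap.restrict (by rintro _ ⟨u, rfl⟩; exact ⟨u, rfl⟩)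
  refine LinearMap.finrank_le_finrank_of_injective (f := g) ?_
  rw [injective_iff_map_eq_zero]
  rintro ⟨_, u, rfl⟩ h
  have h1 : proj (A u) = 0 := congrArg Subtype.val h
  have h2 := heightL_apply_of_gapBoundNear hx hf hA u
  rw [h1, map_zero, mul_zero] at h2
  have h3 := norm_sq_eq (A u)
  rw [h1, h2] at h3
  exact Subtype.ext (by simpa using h3)

/-! ### Existence of approximate derivatives almost everywhere. -/

/-- A Lipschitz map on a null-measurable set is approximately differentiable almost everywhere. -/
theorem ae_exists_hasApproxFDerivAt {F : Type*} [NormedAddCommGroup F] [NormedSpace ℝ F]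
    [FiniteDimensional ℝ F] {f : EuclideanSpace ℝ (Fin k) → F}
    {E K : Set (EuclideanSpace ℝ (Fin k))} (hKE : K ⊆ E) (hK : NullMeasurableSet K volume)
    {C : ℝ≥0} (hf : LipschitzOnWith C f K) :
    ∀ᵐ x ∂volume, x ∈ K → ∃ A : EuclideanSpace ℝ (Fin k) →L[ℝ] F, HasApproxFDerivAt f E x A := by
  -- Rademacher's theorem applies to a Lipschitz extension `g`, which serves `f` at density points
  -- of `K`.
  obtain ⟨g, hg, hfg⟩ := hf.extend_finite_dimension
  have hdens := (ae_restrict_iff'₀ hK).1 (Besicovitch.ae_tendsto_measure_inter_div volume K)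
  filter_upwards [hg.ae_differentiableAt, hdens] with x hgx hx hxK
  refine ⟨fderiv ℝ g x, .of_eqOn hKE hfg hxK ?_ hgx.hasFDerivAt⟩
  have h1 : Tendsto (fun r => 1 - volume (K ∩ Metric.closedBall x r)
      / volume (Metric.closedBall x r)) (𝓝[>] 0) (𝓝 0) := by
    have := ENNReal.Tendsto.sub (tendsto_const_nhds (x := (1 : ENNReal)) (f := 𝓝[>] (0 : ℝ)))
      (hx hxK) (Or.inl ENNReal.one_ne_top)
    simpa using this
  refine h1.congr' ?_
  filter_upwards [self_mem_nhdsWithin] with r (hr : 0 < r)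
  have hB0 : volume (Metric.closedBall x r) ≠ 0 := (Metric.measure_closedBall_pos _ _ hr).ne'
  have hBt : volume (Metric.closedBall x r) ≠ ⊤ := measure_closedBall_lt_top.ne
  have h2 := measure_inter_add_sdiff₀ (Metric.closedBall x r) hK (μ := volume)
  rw [inter_comm] at h2
  have h3 : volume (K ∩ Metric.closedBall x r) ≠ ⊤ := measure_ne_top_of_subset inter_subset_right hBt
  rw [← ENNReal.div_self hB0 hBt, ← ENNReal.sub_div (fun _ _ => hB0), ← h2,
    ENNReal.add_sub_cancel_left h3]

theorem CCLocallyLipschitzOn.local_bounds {f : EuclideanSpace ℝ (Fin k) → Space n}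
    {E : Set (EuclideanSpace ℝ (Fin k))} (hf : CCLocallyLipschitzOn f E)
    {x : EuclideanSpace ℝ (Fin k)} (hx : x ∈ E) :
    (∃ C, GapBoundNear f E x C) ∧
      ∃ C : ℝ≥0, ∃ U : Set (EuclideanSpace ℝ (Fin k)), IsOpen U ∧ x ∈ U ∧
        LipschitzOnWith C f (E ∩ U) := by
  obtain ⟨C, U, hU, hUC⟩ := hf x hx
  obtain ⟨V, hV, hVU⟩ := mem_nhdsWithin_iff_exists_mem_nhds_inter.1 hU
  have hbounds : ∀ p ∈ V ∩ E, ∀ q ∈ V ∩ E, ‖proj (f q) - proj (f p)‖ ≤ C * ‖q - p‖ ∧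
      |verticalGap (f p) (f q)| ≤ 2 * (C * ‖q - p‖) ^ 2 := by
    intro p hp q hq
    refine bounds_of_ccEDist_le (by positivity) ?_
    rw [ENNReal.ofReal_mul (NNReal.coe_nonneg C), ENNReal.ofReal_coe_nnreal, ← dist_eq_norm, dist_comm,
      ← edist_dist]
    exact hUC p (hVU hp) q (hVU hq)
  refine ⟨⟨2 * C ^ 2, V, hV, fun p hp q hq => (hbounds p hp q hq).2.trans (by
    rw [mul_pow, mul_assoc])⟩, ?_⟩
  obtain ⟨r, hr, hrV⟩ := Metric.mem_nhds_iff.1 hV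
  let W := Metric.ball x (min r 1)
  have hWV : W ⊆ V := (Metric.ball_subset_ball (min_le_left _ _)).trans hrV
  let M : ℝ := ‖proj (f x)‖ + C
  have hM0 : 0 ≤ M := by positivity
  -- `C` bounds the projection, `2 * (2 * C ^ 2)` the gap (using `‖q - p‖ ≤ 2` on `W`), and `2 * M *
  -- C` the symplectic term, since `‖proj (f p)‖ ≤ M` there.
  refine ⟨Real.toNNReal (C + (2 * (2 * C ^ 2) + 2 * M * C)), W, Metric.isOpen_ball,
    Metric.mem_ball_self (by positivity), LipschitzOnWith.of_dist_le_mul fun q hq p hp => ?_⟩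
  obtain ⟨h1, h2⟩ := hbounds p ⟨hWV hp.2, hp.1⟩ q ⟨hWV hq.2, hq.1⟩
  have hball : ∀ y ∈ W, ‖y - x‖ ≤ 1 := fun y hy => by
    rw [← dist_eq_norm]
    exact (Metric.mem_ball.1 hy).le.trans (min_le_right _ _)
  have hd2 : ‖q - p‖ ≤ 2 := by
    have := norm_sub_le (q - x) (p - x)
    rw [sub_sub_sub_cancel_right] at this
    linarith [hball q hq.2, hball p hp.2]
  have hpM : ‖proj (f p)‖ ≤ M := by
    have h3 := (hbounds x ⟨mem_of_mem_nhds hV, hx⟩ p ⟨hWV hp.2, hp.1⟩).1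
    have h4 := norm_add_le (proj (f p) - proj (f x)) (proj (f x))
    rw [sub_add_cancel] at h4
    have h5 : C * ‖p - x‖ ≤ C := mul_le_of_le_one_right C.2 (hball p hp.2)
    simp only [M]
    linarith
  have hheight : |heightL n (f q - f p)| ≤ (2 * (2 * C ^ 2) + 2 * M * C) * ‖q - p‖ := by
    have h3 : heightL n (f q - f p) = verticalGap (f p) (f q)
        - 2 * symplecticL n (proj (f p)) (proj (f q) - proj (f p)) := by
      simp [verticalGap, symplecticL_self]
    have h4 : |symplecticL n (proj (f p)) (proj (f q) - proj (f p))| ≤ M * (C * ‖q - p‖) :=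
      (abs_symplecticL_le _ _).trans (by gcongr)
    have h5 : ‖q - p‖ ^ 2 ≤ 2 * ‖q - p‖ := by
      rw [sq]
      gcongr
    rw [h3]
    refine (abs_sub _ _).trans ?_
    rw [abs_mul, abs_two]
    have h6 : 2 * (C * ‖q - p‖) ^ 2 ≤ 2 * (2 * C ^ 2) * ‖q - p‖ :=
      calc 2 * (C * ‖q - p‖) ^ 2 = 2 * C ^ 2 * ‖q - p‖ ^ 2 := by ring
        _ ≤ 2 * C ^ 2 * (2 * ‖q - p‖) := by gcongr
        _ = _ := by ring
    linarith
  rw [dist_eq_norm, dist_eq_norm, Real.coe_toNNReal _ (by positivity), add_mul]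
  refine (norm_le_proj_add_height _).trans (add_le_add ?_ hheight)
  exact h1

theorem ae_exists_hasApproxFDerivAt_of_ccLocallyLipschitzOn
    {f : EuclideanSpace ℝ (Fin k) → Space n} {E : Set (EuclideanSpace ℝ (Fin k))}
    (hE : NullMeasurableSet E volume) (hf : CCLocallyLipschitzOn f E) :
    ∀ᵐ x ∂volume, x ∈ E →
      ∃ A : EuclideanSpace ℝ (Fin k) →L[ℝ] Space n, HasApproxFDerivAt f E x A := by
  -- By the Lindelöf property countably many of these neighbourhoods cover `E`, so the exceptional
  -- null sets can be united.
  choose C U hUo hxU hL using fun x : E => (CCLocallyLipschitzOn.local_bounds hf x.2).2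
  obtain ⟨T, hT, hTU⟩ := TopologicalSpace.isOpen_iUnion_countable U hUo
  have hall : ∀ᵐ x ∂volume, ∀ i ∈ T, x ∈ E ∩ U i →
      ∃ A : EuclideanSpace ℝ (Fin k) →L[ℝ] Space n, HasApproxFDerivAt f E x A :=
    (ae_ball_iff hT).2 fun i _ => ae_exists_hasApproxFDerivAt inter_subset_left
      (hE.inter (hUo i).measurableSet.nullMeasurableSet) (hL i)
  filter_upwards [hall] with x hx hxE
  have : x ∈ ⋃ i ∈ T, U i := hTU ▸ mem_iUnion.2 ⟨⟨x, hxE⟩, hxU _⟩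
  obtain ⟨i, hi, hxi⟩ := mem_iUnion₂.1 this
  exact hx i hi ⟨hxE, hxi⟩

end HeisenbergRank

theorem theorem1p2 (n k : ℕ) (hn : 0 < n) (hk : n < k)
    (E : Set (EuclideanSpace ℝ (Fin k))) (hE : NullMeasurableSet E volume)
    (f : EuclideanSpace ℝ (Fin k) → HeisenbergRank.Space n)
    (hf : HeisenbergRank.CCLocallyLipschitzOn f E) :
    ∀ᵐ x ∂(volume : Measure (EuclideanSpace ℝ (Fin k))), x ∈ E →
      ((∃ A : EuclideanSpace ℝ (Fin k) →L[ℝ] HeisenbergRank.Space n,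
          HeisenbergRank.HasApproxFDerivAt f E x A) ∧
        ∀ A : EuclideanSpace ℝ (Fin k) →L[ℝ] HeisenbergRank.Space n,
          HeisenbergRank.HasApproxFDerivAt f E x A →
            Module.finrank ℝ (LinearMap.range A.toLinearMap) ≤ n) ∧
      ((∃ B : EuclideanSpace ℝ (Fin k) →L[ℝ] HeisenbergRank.Plane n,
          HeisenbergRank.HasApproxFDerivAt (fun y => HeisenbergRank.proj (f y)) E x B) ∧
        ∀ B : EuclideanSpace ℝ (Fin k) →L[ℝ] HeisenbergRank.Plane n,
          HeisenbergRank.HasApproxFDerivAt (fun y => HeisenbergRank.proj (f y)) E x B →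
            HeisenbergRank.IsIsotropic (LinearMap.range B.toLinearMap)) := by
  filter_upwards [HeisenbergRank.ae_exists_hasApproxFDerivAt_of_ccLocallyLipschitzOn hE hf]
    with x hx hxE
  obtain ⟨A, hA⟩ := hx hxE
  obtain ⟨C, hC⟩ := (HeisenbergRank.CCLocallyLipschitzOn.local_bounds hf hxE).1
  exact ⟨⟨⟨A, hA⟩, fun _ h => HeisenbergRank.finrank_range_le_of_gapBoundNear hxE hC h⟩,
    ⟨_, hA.clm_comp (HeisenbergRank.projL n)⟩,
    fun _ h => HeisenbergRank.isIsotropic_range_of_gapBoundNear hxE hC h⟩
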